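/- **Conventions.** Let $\mathbb R^{3\times3}_{sym}$ be the space of symmetric real $3\times3$ matrices with the Frobenius norm, $\sigma:\tau=\sum_{i,j}\sigma_{ij}\tau_{ij}$, $I$ the identity matrix, and for $\sigma\in\mathbb R^{3\times3}_{sym}$ put $p(\sigma)=\tfrac13 I:\sigma$, $s(\sigma)=\sigma-\tfrac13(I:\sigma)I$, $\varrho(\sigma)=\sqrt{s(\sigma):s(\sigma)}$ and, if $\varrho(\sigma)>0$, $n(\sigma)=s(\sigma)/\varrho(\sigma)$. Write $x^+=\max\{0,x\}$. A map $F:X\to Y$ between finite-dimensional normed spaces is *strongly semismooth at $x$* if it is Lipschitz in a neighbourhood of $x$, has all one-sided directional derivatives at $x$, and $F(x+h)-F(x)-Vh=O(\|h\|^2)$ as $h\to0$, uniformly in $V\in\partial F(x+h)$, where $\partial F$ is Clarke's generalized Jacobian (the convex hull of limits of derivatives at nearby points of differentiability). It is strongly semismooth on an open set if it is so at each of its points. **Model.** Let $K,G,\eta,\bar\eta,\xi,c_0>0$, and let $H:[0,\infty)\to[0,\infty)$ be nondecreasing and strongly semismooth with $H(0)=0$ (strong semismoothness at the end point $0$ is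 one-sided: the function $s\mapsto H(s^+)$ is strongly semismooth on $\mathbb R$). Fix $\varepsilon^p_{k-1}\in\mathbb R^{3\times3}_{sym}$ and $\bar\varepsilon^p_{k-1}\ge0$. For $\varepsilon\in\mathbb R^{3\times3}_{sym}$ let $$\sigma^{tr}=K\,(I:\varepsilon^{e,tr})\,I+2G\,s(\varepsilon^{e,tr}),\qquad \varepsilon^{e,tr}=\varepsilon-\varepsilon^p_{k-1},$$ $p^{tr}=p(\sigma^{tr})$, $\varrho^{tr}=\varrho(\sigma^{tr})$, $n^{tr}=n(\sigma^{tr})$, and for $\gamma\ge0$ $$q_{tr}(\gamma)=\sqrt{\tfrac12}\,\bigl(\varrho^{tr}-\gamma G\sqrt2\bigr)^+ +\eta\,(p^{tr}-\gamma K\bar\eta)-\xi\bigl(c_0+H(\bar\varepsilon^p_{k-1}+\gamma\xi)\bigr).$$ The stress–strain operator is $$T(\varepsilon;\varepsilon^p_{k-1},\bar\varepsilon^p_{k-1})=\begin{cases}\sigma^{tr}&\text{if } q_{tr}(0)\le0,\\ \sigma^{tr}-\triangle\lambda\,(G\sqrt2\,n^{tr}+K\bar\eta I)&\text{if } q_{tr}(0)>0,\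 q_{tr}\bigl(\varrho^{tr}/(G\sqrt2)\bigr)<0,\\ (p^{tr}-\triangle\lambda K\bar\eta)\,I&\text{if } q_{tr}\bigl(\varrho^{tr}/(G\sqrt2)\bigr)\ge0,\end{cases}$$ where $\triangle\lambda\ge0$ is the solution of $q_{tr}(\triangle\lambda)=0$. **Theorem.** The operator $T$ is well defined: whenever $q_{tr}(0)\ge0$, the equation $q_{tr}(\gamma)=0$ has exactly one solution $\gamma\ge0$. Moreover, the function $\varepsilon\mapsto T(\varepsilon;\varepsilon^p_{k-1},\bar\varepsilon^p_{k-1})$ is strongly semismooth on all of $\mathbb R^{3\times3}_{sym}$. -/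

import Mathlib

open Set Filter Topology

/-! Strongly semismooth maps between finite dimensional normed spaces -/

section Semismooth

variable {X Y : Type*} [NormedAddCommGroup X] [NormedSpace ℝ X]
  [NormedAddCommGroup Y] [NormedSpace ℝ Y]

/-- The generalized Jacobian of `F` at `x` in the sense of Clarke: the convex hull of all limits
of Fréchet derivatives of `F` along sequences of points of differentiability converging to `x`. -/
def clarkeJacobian (F : X → Y) (x : X) : Set (X →L[ℝ] Y) :=
  convexHull ℝ {V | ∃ u : ℕ → X, Tendsto u atTop (𝓝 x) ∧
    (∀ n, DifferentiableAt ℝ F (u n)) ∧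
    Tendsto (fun n => fderiv ℝ F (u n)) atTop (𝓝 V)}

/-- `F` is strongly semismooth at `x`: it is Lipschitz in a neighbourhood of `x`, it has all
one-sided directional derivatives at `x`, and `F (x + h) - F x - V h = O(‖h‖²)` as `h → 0`,
uniformly in `V ∈ ∂F (x + h)`. -/
structure StronglySemismoothAt (F : X → Y) (x : X) : Prop where
  lipschitz : ∃ L : NNReal, ∃ U ∈ 𝓝 x, LipschitzOnWith L F U
  directional : ∀ h : X, ∃ d : Y,
    Tendsto (fun t : ℝ => t⁻¹ • (F (x + t • h) - F x)) (𝓝[>] 0) (𝓝 d)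
  quadratic : ∃ C δ : ℝ, 0 < δ ∧ ∀ h : X, ‖h‖ < δ → ∀ V ∈ clarkeJacobian F (x + h),
    ‖F (x + h) - F x - V h‖ ≤ C * ‖h‖ ^ 2

/-- `F` is strongly semismooth on the set `O` (meant for open `O`). -/
def StronglySemismoothOn (F : X → Y) (O : Set X) : Prop :=
  ∀ x ∈ O, StronglySemismoothAt F x

end Semismooth

/-! Symmetric second order tensors and their invariants -/

attribute [local instance] Matrix.frobeniusNormedAddCommGroup Matrix.frobeniusNormedSpace

/-- The space of symmetric real `3 × 3` matrices, with the Frobenius norm. -/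
def SymTensor : Submodule ℝ (Matrix (Fin 3) (Fin 3) ℝ) where
  carrier := {A | A.IsSymm}
  add_mem' hA hB := hA.add hB
  zero_mem' := Matrix.isSymm_zero
  smul_mem' c _ hA := hA.smul c

namespace SymTensor

/-- The identity tensor. -/
def one : SymTensor := ⟨1, Matrix.isSymm_one⟩

/-- The double contraction `σ : τ`. -/
def ddot (σ τ : SymTensor) : ℝ := ∑ i, ∑ j, σ.1 i j * τ.1 i j

/-- The hydrostatic pressure `p = (I : σ) / 3`. -/
noncomputable def p (σ : SymTensor) : ℝ := ddot one σ / 3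

/-- The deviatoric part `s = σ - (1/3) (I : σ) I`. -/
noncomputable def dev (σ : SymTensor) : SymTensor := σ - (ddot one σ / 3) • one

/-- The invariant `ϱ = √(s : s)`. -/
noncomputable def rho (σ : SymTensor) : ℝ := √(ddot (dev σ) (dev σ))

/-- The direction `n = s / ϱ` (only used where `ϱ > 0`). -/
noncomputable def n (σ : SymTensor) : SymTensor := (rho σ)⁻¹ • dev σ

end SymTensor

/-! The Drucker-Prager model -/

/-- Data of the Drucker-Prager model: bulk and shear moduli, parameters of the yield function and
of the plastic pseudo-potential, initial cohesion, and the hardening function (of which only the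
values on `[0, ∞)` matter). -/
structure DruckerPrager where
  K : ℝ
  G : ℝ
  η : ℝ
  ηbar : ℝ
  ξ : ℝ
  c₀ : ℝ
  H : ℝ → ℝ

namespace DruckerPrager

/-- The elastic law `D_e : ε = K (I : ε) I + 2 G (I_dev : ε)`. -/
noncomputable def elastic (m : DruckerPrager) (ε : SymTensor) : SymTensor :=
  (m.K * SymTensor.ddot SymTensor.one ε) • SymTensor.one + (2 * m.G) • SymTensor.dev ε

/-- The yield function in the variables `p`, `ϱ`, `κ`. -/
noncomputable def yield (m : DruckerPrager) (p ρ κ : ℝ) : ℝ :=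
  √(1 / 2) * ρ + m.η * p - m.ξ * (m.c₀ + κ)

/-- The function `γ ↦ q(γ; pᵗʳ, ϱᵗʳ, ε̄ᵖᵗʳ)`, considered for `γ ≥ 0`. -/
noncomputable def q (m : DruckerPrager) (ptr ρtr ebar : ℝ) (γ : ℝ) : ℝ :=
  m.yield (ptr - γ * (m.K * m.ηbar)) (max 0 (ρtr - γ * (m.G * √2))) (m.H (ebar + γ * m.ξ))

/-- The function `q_tr` that belongs to a trial stress `σtr`. -/
noncomputable def qtr (m : DruckerPrager) (σtr : SymTensor) (ebar : ℝ) (γ : ℝ) : ℝ :=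
  m.q (SymTensor.p σtr) (SymTensor.rho σtr) ebar γ

open Classical in
/-- The plastic multiplier: the solution `γ ≥ 0` of `q_tr(γ) = 0` (only used where
there is one). -/
noncomputable def multiplier (m : DruckerPrager) (σtr : SymTensor) (ebar : ℝ) : ℝ :=
  if h : ∃ γ, 0 ≤ γ ∧ m.qtr σtr ebar γ = 0 then h.choose else 0

open Classical in
/-- The return mapping `S(σᵗʳ, ε̄ᵖᵗʳ)`: elastic response, return to the smooth portion of the
yield surface, return to the apex. -/
noncomputable def returnMap (m : DruckerPrager) (σtr : SymTensor) (ebar : ℝ) : SymTensor :=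
  if m.qtr σtr ebar 0 ≤ 0 then σtr
  else if m.qtr σtr ebar (SymTensor.rho σtr / (m.G * √2)) < 0 then
    σtr - m.multiplier σtr ebar •
      ((m.G * √2) • SymTensor.n σtr + (m.K * m.ηbar) • SymTensor.one)
  else (SymTensor.p σtr - m.multiplier σtr ebar * (m.K * m.ηbar)) • SymTensor.one

/-- The trial stress `σᵗʳ = D_e : (ε - εᵖ)`, with `epl` the plastic strain of the previous step. -/
noncomputable def trialStress (m : DruckerPrager) (epl ε : SymTensor) : SymTensor :=
  m.elastic (ε - epl)

/-- The stress-strain operator `T(ε; εᵖ, ε̄ᵖ)`, with `epl` and `ebar` the plastic strain and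
the hardening variable of the previous step. -/
noncomputable def T (m : DruckerPrager) (epl : SymTensor) (ebar : ℝ) (ε : SymTensor) :
    SymTensor :=
  m.returnMap (m.trialStress epl ε) ebar

end DruckerPrager

/-! ### Strong semismoothness in terms of directional derivatives -/

section DirSemismooth

variable {X Y Z : Type*} [NormedAddCommGroup X] [NormedSpace ℝ X]
  [NormedAddCommGroup Y] [NormedSpace ℝ Y] [NormedAddCommGroup Z] [NormedSpace ℝ Z]

/-! The three cases of the return map are one formula. Extend `H` to negative arguments by its value
at 0 and let γ be the zero of the extended `q` on the whole line. With γ⁺ = max 0 γ the stress is (p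
− γ⁺ K η̄) I + `softThreshold` (s, γ⁺ G√2), see `returnMap_eq`: γ ≤ 0 is the elastic response, and
the apex is the case where the threshold reaches ϱ and annihilates s. The pressure term makes `q`
decrease at rate at least η K η̄ > 0, so γ exists and is unique, and the operator is a composition
of strongly semismooth maps.

To avoid a chain rule for Clarke Jacobians, the composition is carried out for `DirSemismoothAt`:
directional derivatives exist around x, and F y − F x − F'(y; y − x) = O(‖y − x‖²). This notion is
stable under composition and pairing and implies the Clarke one (`stronglySemismoothAt`). It holds
for C² maps and, by Euler's identity, at the origin for positively homogeneous ones
(`of_posHomogeneous`), which covers the kinks of the positive part, the norm and soft thresholding.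
`DirSemismoothAt.implicit` yields it for γ. The assumption on `H` is in Clarke form; on the line it
converts to the directional form by an absolute continuity argument (`abs_sub_le_of_quadratic`). -/

/-- `d` is the one-sided directional derivative of `F` at `x` in direction `h`. -/
def HasDirDerivAt (F : X → Y) (d : Y) (x h : X) : Prop :=
  Tendsto (fun t : ℝ => t⁻¹ • (F (x + t • h) - F x)) (𝓝[>] 0) (𝓝 d)

/-- Strong semismoothness expressed by directional derivatives instead of Clarke's Jacobian. -/
structure DirSemismoothAt (F : X → Y) (x : X) : Prop where
  lipschitz : ∃ L : NNReal, ∃ U ∈ 𝓝 x, LipschitzOnWith L F U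
  directional : ∀ᶠ y in 𝓝 x, ∀ h : X, ∃ d : Y, HasDirDerivAt F d y h
  quadratic : ∃ C : ℝ, ∀ᶠ y in 𝓝 x, ∀ d, HasDirDerivAt F d y (y - x) →
    ‖F y - F x - d‖ ≤ C * ‖y - x‖ ^ 2

lemma HasDirDerivAt.unique {F : X → Y} {d e : Y} {x h : X} (hd : HasDirDerivAt F d x h)
    (he : HasDirDerivAt F e x h) : d = e :=
  tendsto_nhds_unique hd he

lemma tendsto_add_smul_nhdsGT (x h : X) :
    Tendsto (fun t : ℝ => x + t • h) (𝓝[>] 0) (𝓝 x) := by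
  have : Continuous fun t : ℝ => x + t • h := by fun_prop
  simpa using (this.tendsto 0).mono_left nhdsWithin_le_nhds

lemma HasDirDerivAt.congr {F G : X → Y} {d : Y} {x h : X} (hd : HasDirDerivAt F d x h)
    (hFG : F =ᶠ[𝓝 x] G) : HasDirDerivAt G d x h := by
  refine Tendsto.congr' ?_ hd
  filter_upwards [(tendsto_add_smul_nhdsGT x h).eventually hFG] with t ht
  rw [ht, hFG.self_of_nhds]

lemma HasFDerivAt.hasDirDerivAt {F : X → Y} {F' : X →L[ℝ] Y} {x : X} (hF : HasFDerivAt F F' x)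
    (h : X) : HasDirDerivAt F (F' h) x h := by
  have := (hF.hasLineDerivAt h).tendsto_slope_zero
  exact this.mono_left (nhdsWithin_mono _ fun t ht => ne_of_gt ht)

/-- Directional derivatives of a locally Lipschitz function are Lipschitz in the direction. -/
lemma HasDirDerivAt.norm_sub_le {F : X → Y} {d e : Y} {x h k : X} {L : NNReal} {U : Set X}
    (hL : LipschitzOnWith L F U) (hU : U ∈ 𝓝 x)
    (hd : HasDirDerivAt F d x h) (he : HasDirDerivAt F e x k) :
    ‖d - e‖ ≤ L * ‖h - k‖ := by
  refine le_of_tendsto (hd.sub he).norm ?_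
  filter_upwards [(tendsto_add_smul_nhdsGT x h).eventually hU,
    (tendsto_add_smul_nhdsGT x k).eventually hU, self_mem_nhdsWithin] with t h1 h2 ht
  have ht : 0 < t := ht
  rw [← smul_sub, norm_smul, norm_inv, Real.norm_of_nonneg ht.le, inv_mul_le_iff₀ ht]
  have := hL.norm_sub_le h1 h2
  rw [add_sub_add_left_eq_sub, ← smul_sub, norm_smul, Real.norm_of_nonneg ht.le] at this
  rw [sub_sub_sub_cancel_right]
  linarith

/-- The Lipschitz bound on `g` allows f (x + t h) to be replaced by f x + t d at the cost of an o(t)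
error. -/
lemma HasDirDerivAt.comp {f : X → Y} {g : Y → Z} {x h : X} {d : Y} {e : Z} {L : NNReal}
    {U : Set Y} (hL : LipschitzOnWith L g U) (hU : U ∈ 𝓝 (f x)) (hf : ContinuousAt f x)
    (hd : HasDirDerivAt f d x h) (he : HasDirDerivAt g e (f x) d) :
    HasDirDerivAt (g ∘ f) e x h := by
  have h0 : Tendsto (fun t : ℝ => t⁻¹ • (g (f (x + t • h)) - g (f x + t • d))) (𝓝[>] 0)
      (𝓝 0) := by
    have hb : Tendsto (fun t : ℝ => L * ‖t⁻¹ • (f (x + t • h) - f x) - d‖) (𝓝[>] 0) (𝓝 0) := by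
      simpa using ((Tendsto.sub_const hd d).norm).const_mul (L : ℝ)
    refine squeeze_zero_norm' ?_ hb
    filter_upwards [(hf.tendsto.comp (tendsto_add_smul_nhdsGT x h)).eventually hU,
      (tendsto_add_smul_nhdsGT (f x) d).eventually hU, self_mem_nhdsWithin] with t h1 h2 ht
    have ht : 0 < t := ht
    have h3 := hL.norm_sub_le h1 h2
    have h4 : f (x + t • h) - (f x + t • d) = t • (t⁻¹ • (f (x + t • h) - f x) - d) := by
      rw [smul_sub, smul_inv_smul₀ ht.ne']; abel
    simp only [Function.comp_apply] at h3
    rw [h4, norm_smul, Real.norm_of_nonneg ht.le] at h3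
    rw [norm_smul, norm_inv, Real.norm_of_nonneg ht.le, inv_mul_le_iff₀ ht]
    linarith
  have := h0.add he
  rw [zero_add] at this
  refine this.congr fun t => ?_
  rw [← smul_add, sub_add_sub_cancel]
  rfl

lemma HasDirDerivAt.prodMk {f : X → Y} {g : X → Z} {x h : X} {d : Y} {e : Z}
    (hd : HasDirDerivAt f d x h) (he : HasDirDerivAt g e x h) :
    HasDirDerivAt (fun x => (f x, g x)) (d, e) x h :=
  Tendsto.prodMk_nhds hd he

namespace DirSemismoothAt

lemma continuousAt {F : X → Y} {x : X} (hF : DirSemismoothAt F x) : ContinuousAt F x := by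
  obtain ⟨L, U, hU, hL⟩ := hF.lipschitz
  exact hL.continuousOn.continuousAt hU

lemma eventually_continuousAt {F : X → Y} {x : X} (hF : DirSemismoothAt F x) :
    ∀ᶠ y in 𝓝 x, ContinuousAt F y := by
  obtain ⟨L, U, hU, hL⟩ := hF.lipschitz
  filter_upwards [eventually_mem_nhds_iff.2 hU] with y hy
  exact hL.continuousOn.continuousAt hy

lemma congr {F G : X → Y} {x : X} (hF : DirSemismoothAt F x) (hFG : F =ᶠ[𝓝 x] G) :
    DirSemismoothAt G x := by
  obtain ⟨L, U, hU, hL⟩ := hF.lipschitz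
  obtain ⟨C, hC⟩ := hF.quadratic
  refine ⟨⟨L, U ∩ {y | F y = G y}, inter_mem hU hFG, ?_⟩, ?_, C, ?_⟩
  · intro y hy z hz
    rw [← show F y = G y from hy.2, ← show F z = G z from hz.2]
    exact hL hy.1 hz.1
  · filter_upwards [hF.directional, hFG.eventually_nhds] with y hy hyG h
    obtain ⟨d, hd⟩ := hy h
    exact ⟨d, hd.congr hyG⟩
  · filter_upwards [hC, hFG.eventually_nhds] with y hy hyG d hd
    rw [← hyG.self_of_nhds, ← hFG.self_of_nhds]
    exact hy d (hd.congr (hyG.mono fun _ h => h.symm))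

/-- Strong semismoothness in the directional sense implies strong semismoothness. -/
lemma stronglySemismoothAt {F : X → Y} {x : X} (hF : DirSemismoothAt F x) :
    StronglySemismoothAt F x := by
  refine ⟨hF.lipschitz, hF.directional.self_of_nhds, ?_⟩
  obtain ⟨C, hC⟩ := hF.quadratic
  obtain ⟨δ, hδ, hball⟩ := Metric.eventually_nhds_iff_ball.1
    (hC.eventually_nhds.and hF.eventually_continuousAt)
  refine ⟨C, δ, hδ, fun h hh V hV => ?_⟩
  obtain ⟨hquad, hcont⟩ := hball (x + h) (by simpa using hh)
  -- The estimate is a convex condition on V, so it need only be checked on limits of derivatives;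
  -- there it is the limit of the directional estimate at the points `u n`.
  have hconv : Convex ℝ {V : X →L[ℝ] Y | ‖F (x + h) - F x - V h‖ ≤ C * ‖h‖ ^ 2} := by
    intro V hV W hW a b ha hb hab
    simp only [mem_ofPred_eq] at hV hW ⊢
    have : F (x + h) - F x - (a • V + b • W) h
        = a • (F (x + h) - F x - V h) + b • (F (x + h) - F x - W h) := by
      rw [smul_sub a (F (x + h) - F x), smul_sub b (F (x + h) - F x), sub_add_sub_comm, ← add_smul,
        hab, one_smul]
      rfl
    rw [this]
    refine (norm_add_le _ _).trans ?_
    rw [norm_smul, norm_smul, Real.norm_of_nonneg ha, Real.norm_of_nonneg hb]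
    calc a * ‖F (x + h) - F x - V h‖ + b * ‖F (x + h) - F x - W h‖
        ≤ a * (C * ‖h‖ ^ 2) + b * (C * ‖h‖ ^ 2) := by gcongr
      _ = (a + b) * (C * ‖h‖ ^ 2) := by ring
      _ = C * ‖h‖ ^ 2 := by rw [hab, one_mul]
  refine convexHull_min ?_ hconv hV
  rintro V ⟨u, hu, hdiff, hlim⟩
  have hu' : Tendsto (fun n => u n - x) atTop (𝓝 h) := by
    simpa using hu.sub_const x
  have h1 : Tendsto (fun n => ‖F (u n) - F x - fderiv ℝ F (u n) (u n - x)‖) atTop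
      (𝓝 ‖F (x + h) - F x - V h‖) :=
    (((hcont.tendsto.comp hu).sub_const _).sub
      ((isBoundedBilinearMap_apply.continuous.tendsto (V, h)).comp (hlim.prodMk_nhds hu'))).norm
  refine le_of_tendsto_of_tendsto h1 ((hu'.norm.pow 2).const_mul C) ?_
  filter_upwards [hu.eventually hquad] with n hn
  exact hn _ ((hdiff n).hasFDerivAt.hasDirDerivAt _)

/-- The derivatives of `g` at f y in the directions f y − f x and f'(y; y − x) differ by at most L
times the distance of these directions, which is quadratically small by the estimate for `f`. -/
lemma comp {f : X → Y} {g : Y → Z} {x : X} (hg : DirSemismoothAt g (f x))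
    (hf : DirSemismoothAt f x) : DirSemismoothAt (g ∘ f) x := by
  have hdir := hf.continuousAt.eventually hg.directional
  have hcont := hf.eventually_continuousAt
  obtain ⟨L, U, hU, hL⟩ := hg.lipschitz
  obtain ⟨K, W, hW, hK⟩ := hf.lipschitz
  obtain ⟨C, hC⟩ := hf.quadratic
  obtain ⟨D, hD⟩ := hg.quadratic
  have hU' : ∀ᶠ y in 𝓝 x, U ∈ 𝓝 (f y) :=
    hf.continuousAt.eventually (eventually_mem_nhds_iff.2 hU)
  refine ⟨⟨L * K, W ∩ f ⁻¹' U, inter_mem hW (hf.continuousAt hU), ?_⟩, ?_, ?_⟩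
  · exact hL.comp (hK.mono inter_subset_left) fun y hy => hy.2
  · filter_upwards [hdir, hf.directional, hcont, hU'] with y h1 h2 h3 h4 h
    obtain ⟨d, hd⟩ := h2 h
    obtain ⟨e, he⟩ := h1 d
    exact ⟨e, hd.comp hL h4 h3 he⟩
  · refine ⟨|D| * K ^ 2 + L * C, ?_⟩
    filter_upwards [hdir, hf.directional, hcont, hU', hC, hf.continuousAt.eventually hD, hW]
      with y h1 h2 h3 h4 h5 h6 hyW e' he'
    obtain ⟨d, hd⟩ := h2 (y - x)
    obtain ⟨e, he⟩ := h1 d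
    obtain rfl := he'.unique (hd.comp hL h4 h3 he)
    obtain ⟨a, ha⟩ := h1 (f y - f x)
    have i1 := h6 a ha
    have i2 := h5 d hd
    have i3 := ha.norm_sub_le hL h4 he
    have i4 := hK.norm_sub_le hyW (mem_of_mem_nhds hW)
    have i5 : ‖f y - f x‖ ^ 2 ≤ (K * ‖y - x‖) ^ 2 := by gcongr
    calc ‖g (f y) - g (f x) - e'‖ = ‖(g (f y) - g (f x) - a) + (a - e')‖ := by congr 1; abel
      _ ≤ D * ‖f y - f x‖ ^ 2 + L * ‖f y - f x - d‖ := (norm_add_le _ _).trans (add_le_add i1 i3)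
      _ ≤ |D| * (K * ‖y - x‖) ^ 2 + L * (C * ‖y - x‖ ^ 2) := by
        gcongr
        exact le_abs_self D
      _ = _ := by ring

lemma prodMk {f : X → Y} {g : X → Z} {x : X} (hf : DirSemismoothAt f x)
    (hg : DirSemismoothAt g x) : DirSemismoothAt (fun x => (f x, g x)) x := by
  obtain ⟨L, U, hU, hL⟩ := hf.lipschitz
  obtain ⟨K, W, hW, hK⟩ := hg.lipschitz
  obtain ⟨C, hC⟩ := hf.quadratic
  obtain ⟨D, hD⟩ := hg.quadratic
  refine ⟨⟨max L K, U ∩ W, inter_mem hU hW, ?_⟩, ?_, max C D, ?_⟩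
  · exact (hL.mono inter_subset_left).prodMk (hK.mono inter_subset_right)
  · filter_upwards [hf.directional, hg.directional] with y h1 h2 h
    obtain ⟨d, hd⟩ := h1 h
    obtain ⟨e, he⟩ := h2 h
    exact ⟨_, hd.prodMk he⟩
  · filter_upwards [hf.directional, hg.directional, hC, hD] with y h1 h2 h3 h4 a ha
    obtain ⟨d, hd⟩ := h1 (y - x)
    obtain ⟨e, he⟩ := h2 (y - x)
    obtain rfl := ha.unique (hd.prodMk he)
    rw [Prod.mk_sub_mk, Prod.mk_sub_mk, Prod.norm_mk, max_mul_of_nonneg _ _ (by positivity)]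
    exact max_le_max (h3 d hd) (h4 e he)

/-- Twice continuously differentiable maps are strongly semismooth. -/
lemma of_contDiffAt {f : X → Y} {x : X} (hf : ContDiffAt ℝ 2 f x) : DirSemismoothAt f x := by
  have hf1 : ContDiffAt ℝ 1 f x := hf.of_le one_le_two
  have hdiff : ∀ᶠ y in 𝓝 x, DifferentiableAt ℝ f y :=
    (hf1.eventually (by simp)).mono fun y hy => hy.differentiableAt one_ne_zero
  refine ⟨hf1.exists_lipschitzOnWith, ?_, ?_⟩
  · filter_upwards [hdiff] with y hy h
    exact ⟨_, hy.hasFDerivAt.hasDirDerivAt h⟩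
  · obtain ⟨L, U, hU, hL⟩ := (hf.fderiv_right (m := 1) (by norm_num)).exists_lipschitzOnWith
    obtain ⟨δ, hδ, hball⟩ := Metric.eventually_nhds_iff_ball.1 (hdiff.and hU)
    refine ⟨L * 2, ?_⟩
    filter_upwards [Metric.ball_mem_nhds x hδ] with y hy d hd
    obtain rfl := hd.unique ((hball y hy).1.hasFDerivAt.hasDirDerivAt _)
    have hsub : segment ℝ x y ⊆ Metric.ball x δ :=
      (convex_ball x δ).segment_subset (Metric.mem_ball_self hδ) hy
    -- Mean value inequality relative to the derivative at the far end y, where the directional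
    -- derivative is taken. The factor 2 in the final constant is slack.
    have key := (convex_segment (𝕜 := ℝ) x y).norm_image_sub_le_of_norm_fderiv_le'
      (f := f) (φ := fderiv ℝ f y) (C := L * ‖y - x‖)
      (fun z hz => (hball z (hsub hz)).1)
      (fun z hz => by
        refine (hL.norm_sub_le (hball z (hsub hz)).2 (hball y hy).2).trans ?_
        gcongr
        rw [← dist_eq_norm, ← dist_eq_norm, dist_comm z y, dist_comm y x]
        have := dist_add_dist_of_mem_segment hz
        have := dist_nonneg (x := x) (y := z)
        rw [dist_comm y z]
        linarith)
      (left_mem_segment ℝ x y) (right_mem_segment ℝ x y)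
    refine key.trans (le_of_eq_of_le ?_ (mul_le_mul_of_nonneg_right
      (show (L : ℝ) ≤ L * 2 by linarith [L.2]) (by positivity)))
    ring

/-- A positively homogeneous map which is Lipschitz near the origin and directionally
differentiable off the origin is strongly semismooth at the origin. -/
lemma of_posHomogeneous {f : X → Y} (hf : ∀ t : ℝ, 0 < t → ∀ x, f (t • x) = t • f x)
    (hlip : ∃ L : NNReal, ∃ U ∈ 𝓝 (0 : X), LipschitzOnWith L f U)
    (hdir : ∀ x ≠ 0, ∀ h, ∃ d, HasDirDerivAt f d x h) : DirSemismoothAt f 0 := by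
  have h0 : f 0 = 0 := by
    have := hf 2 two_pos 0
    rw [smul_zero, two_smul] at this
    simpa using this
  refine ⟨hlip, Eventually.of_forall fun y h => ?_, 0, Eventually.of_forall fun y d hd => ?_⟩
  · rcases eq_or_ne y 0 with rfl | hy
    · refine ⟨f h, tendsto_const_nhds.congr' ?_⟩
      filter_upwards [self_mem_nhdsWithin] with t (ht : 0 < t)
      rw [zero_add, hf t ht, h0, sub_zero, inv_smul_smul₀ ht.ne']
    · exact hdir y hy h
  -- Euler's identity f'(y; y) = f y makes the remainder vanish, hence the constant 0.
  · have : HasDirDerivAt f (f y) y (y - 0) := by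
      refine tendsto_const_nhds.congr' ?_
      filter_upwards [self_mem_nhdsWithin] with t (ht : 0 < t)
      have : y + t • (y - 0) = (1 + t) • y := by rw [sub_zero, add_smul, one_smul]
      rw [this, hf _ (by linarith), add_smul, one_smul, add_sub_cancel_left,
        inv_smul_smul₀ ht.ne']
    rw [hd.unique this, h0]
    simp

lemma max_zero (x : ℝ) : DirSemismoothAt (fun t : ℝ => max 0 t) x := by
  have hne : ∀ x : ℝ, x ≠ 0 → DirSemismoothAt (fun t : ℝ => max 0 t) x := by
    intro x hx
    rcases hx.lt_or_gt with hx | hx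
    · refine (of_contDiffAt (contDiffAt_const (c := (0 : ℝ)))).congr ?_
      filter_upwards [Iio_mem_nhds hx] with t ht
      exact (max_eq_left (le_of_lt ht)).symm
    · refine (of_contDiffAt contDiffAt_id).congr ?_
      filter_upwards [Ioi_mem_nhds hx] with t ht
      exact (max_eq_right (le_of_lt ht)).symm
  rcases eq_or_ne x 0 with rfl | hx
  · refine of_posHomogeneous (fun t ht x => ?_) ⟨1, univ, univ_mem, ?_⟩
      fun x hx => (hne x hx).directional.self_of_nhds
    · simp only [smul_eq_mul]
      rw [mul_max_of_nonneg _ _ ht.le, mul_zero]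
    · exact (LipschitzWith.id.const_max 0).lipschitzOnWith
  · exact hne x hx

lemma norm (hX : ∀ x : X, x ≠ 0 → ContDiffAt ℝ 2 (fun y : X => ‖y‖) x) (x : X) :
    DirSemismoothAt (fun y : X => ‖y‖) x := by
  rcases eq_or_ne x 0 with rfl | hx
  · refine of_posHomogeneous (fun t ht x => ?_) ⟨1, univ, univ_mem, ?_⟩
      fun x hx => (of_contDiffAt (hX x hx)).directional.self_of_nhds
    · rw [norm_smul, Real.norm_of_nonneg ht.le, smul_eq_mul]
    · exact lipschitzWith_one_norm.lipschitzOnWith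
  · exact of_contDiffAt (hX x hx)

lemma add {f g : X → Y} {x : X} (hf : DirSemismoothAt f x) (hg : DirSemismoothAt g x) :
    DirSemismoothAt (fun x => f x + g x) x :=
  comp (g := fun p : Y × Y => p.1 + p.2) (of_contDiffAt contDiff_add.contDiffAt) (hf.prodMk hg)

lemma sub {f g : X → Y} {x : X} (hf : DirSemismoothAt f x) (hg : DirSemismoothAt g x) :
    DirSemismoothAt (fun x => f x - g x) x :=
  comp (g := fun p : Y × Y => p.1 - p.2)
    (of_contDiffAt (contDiff_fst.sub contDiff_snd).contDiffAt) (hf.prodMk hg)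

lemma smul {f : X → ℝ} {g : X → Y} {x : X} (hf : DirSemismoothAt f x)
    (hg : DirSemismoothAt g x) : DirSemismoothAt (fun x => f x • g x) x :=
  comp (g := fun p : ℝ × Y => p.1 • p.2) (of_contDiffAt contDiff_smul.contDiffAt) (hf.prodMk hg)

lemma const (c : Y) (x : X) : DirSemismoothAt (fun _ => c) x :=
  of_contDiffAt contDiffAt_const

lemma fst (p : X × Y) : DirSemismoothAt Prod.fst p :=
  of_contDiffAt contDiffAt_fst

lemma snd (p : X × Y) : DirSemismoothAt Prod.snd p :=
  of_contDiffAt contDiffAt_snd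

end DirSemismoothAt

end DirSemismooth

/-! ### Scalar functions: from Clarke to directional semismoothness, strongly decreasing functions
-/

section ScalarFunctions

/-- If `φ y - φ x - φ' y (y - x)` is quadratically small at the points of differentiability near
`x`, then the increments of `φ` along rays from `x` are proportional up to second order. -/
lemma abs_sub_le_of_quadratic {φ : ℝ → ℝ} {x C ε : ℝ} {L : NNReal}
    (hL : LipschitzOnWith L φ (Metric.ball x ε))
    (hC : ∀ z ∈ Metric.ball x ε, DifferentiableAt ℝ φ z →
      |φ z - φ x - deriv φ z * (z - x)| ≤ C * (z - x) ^ 2)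
    {t τ : ℝ} (ht : t ≠ 0) (hτ : 0 < τ) (hmem : (1 + τ) * |t| < ε) :
    |φ (x + t + τ * t) - φ (x + t) - τ * (φ (x + t) - φ x)| ≤ C * t ^ 2 * (τ * (1 + τ)) := by
  have hball : ∀ r ∈ Icc 1 (1 + τ), x + r * t ∈ Metric.ball x ε := by
    intro r hr
    rw [Metric.mem_ball, Real.dist_eq, add_sub_cancel_left, abs_mul,
      abs_of_pos (by linarith [hr.1])]
    exact (mul_le_mul_of_nonneg_right hr.2 (abs_nonneg t)).trans_lt hmem
  have hI : uIcc 1 (1 + τ) = Icc 1 (1 + τ) := uIcc_of_le (by linarith)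
  -- With z = x + r t, the derivative of this quotient is −(φ z − φ x − φ'(z)(z − x)) / r², hence at
  -- most C t² in absolute value. Being absolutely continuous, `k` is recovered from its a.e.
  -- derivative.
  let k : ℝ → ℝ := fun r => (φ (x + r * t) - φ x) * r⁻¹
  have hk1 : AbsolutelyContinuousOnInterval (fun r => φ (x + r * t) - φ x) 1 (1 + τ) := by
    refine LipschitzOnWith.absolutelyContinuousOnInterval (K := L * ‖t‖₊) ?_
    rw [hI]
    refine LipschitzOnWith.of_dist_le_mul fun r hr s hs => ?_
    have := hL.dist_le_mul _ (hball r hr) _ (hball s hs)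
    rw [dist_sub_right]
    refine this.trans (le_of_eq ?_)
    rw [dist_add_left, Real.dist_eq, Real.dist_eq, ← sub_mul, abs_mul]
    push_cast
    rw [Real.norm_eq_abs]
    ring
  have hk2 : AbsolutelyContinuousOnInterval (fun r : ℝ => r⁻¹) 1 (1 + τ) := by
    refine ContDiffOn.absolutelyContinuousOnInterval ?_
    rw [hI]
    exact contDiffOn_id.inv fun r hr => by simp only [id]; linarith [hr.1]
  have hk : AbsolutelyContinuousOnInterval k 1 (1 + τ) := hk1.mul hk2
  have hbound : ∀ᵐ r, r ∈ uIoc 1 (1 + τ) → ‖deriv k r‖ ≤ C * t ^ 2 := by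
    filter_upwards [hk.ae_differentiableAt] with r hr hr'
    have hrI := uIoc_subset_uIcc hr'
    have hkr := hr hrI
    rw [hI] at hrI
    have hr0 : 0 < r := by linarith [hrI.1]
    set z := x + r * t with hz
    have hzr : (z - x) / t = r := by rw [hz]; field_simp; ring
    have hdiff : DifferentiableAt ℝ φ z := by
      -- Solving the definition of `k` for φ transfers differentiability from `k` at r to φ at z.
      have h1 : DifferentiableAt ℝ (fun w => φ x + k ((w - x) / t) * ((w - x) / t)) z := by
        have h2 : DifferentiableAt ℝ (fun w => (w - x) / t) z := by fun_prop
        have h3 : DifferentiableAt ℝ (fun w => k ((w - x) / t)) z :=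
          DifferentiableAt.comp z (g := k) (by rwa [hzr]) h2
        exact (h3.mul h2).const_add _
      refine h1.congr_of_eventuallyEq ?_
      have hzx : z ≠ x := by
        rw [hz]
        simpa using ⟨hr0.ne', ht⟩
      filter_upwards [isOpen_ne.mem_nhds hzx] with w hw
      have hw' : w - x ≠ 0 := sub_ne_zero.2 hw
      have : x + (w - x) / t * t = w := by field_simp; ring
      simp only [k, this]
      field_simp
      ring
    have hder : HasDerivAt k (deriv φ z * t * r⁻¹ + (φ z - φ x) * (-(r ^ 2)⁻¹)) r := by
      have h1 : HasDerivAt (fun r => x + r * t) t r := by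
        simpa using ((hasDerivAt_id r).mul_const t).const_add x
      exact ((HasDerivAt.comp r hdiff.hasDerivAt h1).sub_const _).mul (hasDerivAt_inv hr0.ne')
    rw [hder.deriv, Real.norm_eq_abs]
    have h3 := hC z (hball r hrI) hdiff
    have h4 : deriv φ z * t * r⁻¹ + (φ z - φ x) * (-(r ^ 2)⁻¹)
        = -(φ z - φ x - deriv φ z * (z - x)) / r ^ 2 := by
      rw [show z - x = r * t by rw [hz]; ring]
      field_simp
      ring
    rw [h4, abs_div, abs_neg, abs_of_pos (by positivity : 0 < r ^ 2), div_le_iff₀ (by positivity)]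
    refine h3.trans (le_of_eq ?_)
    rw [show z - x = r * t by rw [hz]; ring]
    ring
  have hint := intervalIntegral.norm_integral_le_of_norm_le_const_ae hbound
  rw [hk.integral_deriv_eq_sub, Real.norm_eq_abs, add_sub_cancel_left, abs_of_pos hτ] at hint
  have hτ1 : (0 : ℝ) < 1 + τ := by linarith
  have hrw : φ (x + t + τ * t) - φ (x + t) - τ * (φ (x + t) - φ x)
      = (1 + τ) * (k (1 + τ) - k 1) := by
    simp only [k]
    rw [show x + (1 + τ) * t = x + t + τ * t by ring, one_mul]
    field_simp
    ring
  rw [hrw, abs_mul, abs_of_pos hτ1]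
  calc (1 + τ) * |k (1 + τ) - k 1| ≤ (1 + τ) * (C * t ^ 2 * τ) := by gcongr
    _ = _ := by ring

/-- For scalar functions on the line, strong semismoothness implies its directional version. -/
lemma StronglySemismoothAt.dirSemismoothAt {φ : ℝ → ℝ} (hφ : ∀ x, StronglySemismoothAt φ x)
    (x : ℝ) : DirSemismoothAt φ x := by
  refine ⟨(hφ x).lipschitz, Eventually.of_forall fun y => (hφ y).directional, ?_⟩
  obtain ⟨L, U, hU, hL⟩ := (hφ x).lipschitz
  obtain ⟨C, δ, hδ, hC⟩ := (hφ x).quadratic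
  obtain ⟨ε', hε', hεU⟩ := Metric.mem_nhds_iff.1 hU
  set ε := min ε' δ
  have hε : 0 < ε := lt_min hε' hδ
  have hLb : LipschitzOnWith L φ (Metric.ball x ε) :=
    hL.mono ((Metric.ball_subset_ball (min_le_left _ _)).trans hεU)
  have hCb : ∀ z ∈ Metric.ball x ε, DifferentiableAt ℝ φ z →
      |φ z - φ x - deriv φ z * (z - x)| ≤ C * (z - x) ^ 2 := by
    intro z hz hd
    -- A constant sequence places the derivative at z in the Clarke Jacobian.
    have h1 : fderiv ℝ φ z ∈ clarkeJacobian φ (x + (z - x)) := by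
      rw [add_sub_cancel]
      exact subset_convexHull ℝ _ ⟨fun _ => z, tendsto_const_nhds, fun _ => hd, tendsto_const_nhds⟩
    have h2 := hC (z - x) (by
      rw [← dist_eq_norm]
      exact (Metric.mem_ball.1 hz).trans_le (min_le_right _ _)) _ h1
    rw [add_sub_cancel, Real.norm_eq_abs, Real.norm_eq_abs, sq_abs, fderiv_eq_smul_deriv,
      smul_eq_mul, mul_comm (z - x)] at h2
    exact h2
  refine ⟨C, ?_⟩
  filter_upwards [Metric.ball_mem_nhds x hε] with y hy d hd
  rcases eq_or_ne y x with rfl | hyx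
  · have : d = 0 := tendsto_nhds_unique hd (by simp)
    simp [this]
  set t := y - x with ht
  have ht0 : t ≠ 0 := sub_ne_zero.2 hyx
  have hyt : y = x + t := by rw [ht]; ring
  have hlt : |t| < ε := by rwa [Metric.mem_ball, Real.dist_eq] at hy
  have hlim : Tendsto (fun τ : ℝ => |(φ y - φ x) - τ⁻¹ • (φ (y + τ • t) - φ y)|) (𝓝[>] 0)
      (𝓝 |φ y - φ x - d|) := (Tendsto.const_sub _ hd).abs
  have hlim2 : Tendsto (fun τ : ℝ => C * t ^ 2 * (1 + τ)) (𝓝[>] 0) (𝓝 (C * t ^ 2)) := by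
    have : Continuous fun τ : ℝ => C * t ^ 2 * (1 + τ) := by fun_prop
    simpa using (this.tendsto 0).mono_left nhdsWithin_le_nhds
  have hsmall : ∀ᶠ τ : ℝ in 𝓝[>] 0, (1 + τ) * |t| < ε := by
    have : Continuous fun τ : ℝ => (1 + τ) * |t| := by fun_prop
    have h0 := (this.tendsto 0).mono_left (nhdsWithin_le_nhds (s := Ioi 0))
    exact h0.eventually (Iio_mem_nhds (by simpa using hlt))
  rw [Real.norm_eq_abs, Real.norm_eq_abs, sq_abs]
  refine le_of_tendsto_of_tendsto hlim hlim2 ?_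
  filter_upwards [hsmall, self_mem_nhdsWithin] with τ h1 (hτ : 0 < τ)
  -- After division by τ the bound is C t² (1 + τ), so letting τ → 0 keeps the constant C.
  have key := abs_sub_le_of_quadratic hLb hCb ht0 hτ h1
  rw [← hyt] at key
  have : (φ y - φ x) - τ⁻¹ • (φ (y + τ • t) - φ y)
      = -(τ⁻¹ * (φ (y + τ * t) - φ y - τ * (φ y - φ x))) := by
    simp only [smul_eq_mul]
    field_simp
    ring
  rw [this, abs_neg, abs_mul, abs_of_pos (inv_pos.2 hτ), inv_mul_le_iff₀ hτ]
  exact key.trans (le_of_eq (by ring))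

/-- A continuous function that decreases at least at a linear rate has a zero. -/
lemma exists_zero_of_strongly_decreasing {f : ℝ → ℝ} {c : ℝ} (hc : 0 < c) (hf : Continuous f)
    (hdec : ∀ a b, a ≤ b → f b ≤ f a - c * (b - a)) : ∃ a, f a = 0 := by
  have hpos : 0 ≤ |f 0| / c := by positivity
  have h1 : f (|f 0| / c) ≤ 0 := by
    have := hdec 0 _ hpos
    rw [sub_zero, mul_div_cancel₀ _ hc.ne'] at this
    linarith [le_abs_self (f 0)]
  have h2 : 0 ≤ f (-(|f 0| / c)) := by
    have := hdec (-(|f 0| / c)) 0 (by linarith)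
    rw [zero_sub, neg_neg, mul_div_cancel₀ _ hc.ne'] at this
    linarith [neg_abs_le (f 0)]
  exact mem_range_of_exists_le_of_exists_ge hf ⟨_, h1⟩ ⟨_, h2⟩

/-- Turns a small residual into a small distance to the zero; uniqueness, continuity and Lipschitz
bounds of the multiplier all come from it. -/
lemma mul_abs_sub_le_of_strongly_decreasing {f : ℝ → ℝ} {c : ℝ}
    (hdec : ∀ a b, a ≤ b → f b ≤ f a - c * (b - a)) (a b : ℝ) : c * |a - b| ≤ |f a - f b| := by
  rcases le_total a b with h | h
  · have := hdec a b h
    rw [abs_of_nonpos (by linarith)]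
    linarith [le_abs_self (f a - f b)]
  · have := hdec b a h
    rw [abs_of_nonneg (by linarith)]
    linarith [neg_abs_le (f a - f b)]

end ScalarFunctions

/-! ### Implicit functions -/

section Implicit

variable {Z : Type*} [NormedAddCommGroup Z] [NormedSpace ℝ Z]

/-- Implicit function theorem: the zero of a strongly semismooth function which is strongly
decreasing in its scalar argument depends on the parameter in a strongly semismooth way. -/
lemma DirSemismoothAt.implicit {Q : ℝ × Z → ℝ} {γ : Z → ℝ} {c : ℝ} (hc : 0 < c)
    (hdec : ∀ z a b, a ≤ b → Q (b, z) ≤ Q (a, z) - c * (b - a))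
    (hγ : ∀ z, Q (γ z, z) = 0) (hQ : ∀ p, DirSemismoothAt Q p) (z₀ : Z) :
    DirSemismoothAt γ z₀ := by
  have hcont : ∀ z, ContinuousAt γ z := by
    intro z
    have h1 : Tendsto (fun y => c⁻¹ * |Q (γ z, y)|) (𝓝 z) (𝓝 0) := by
      have h2 : ContinuousAt (fun y => Q (γ z, y)) z :=
        ContinuousAt.comp (g := Q) (hQ (γ z, z)).continuousAt (by fun_prop)
      have := (h2.tendsto.abs).const_mul c⁻¹
      rwa [hγ, abs_zero, mul_zero] at this
    rw [ContinuousAt, tendsto_iff_norm_sub_tendsto_zero]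
    refine squeeze_zero (fun _ => norm_nonneg _) (fun y => ?_) h1
    have := mul_abs_sub_le_of_strongly_decreasing (hdec y) (γ y) (γ z)
    rw [hγ, zero_sub, abs_neg] at this
    rwa [Real.norm_eq_abs, le_inv_mul_iff₀ hc]
  -- The strong decrease survives division by t and passes to the directional derivatives of `Q`.
  have hslope : ∀ (p : ℝ × Z) (h : Z) (a b d e : ℝ), a ≤ b → HasDirDerivAt Q d p (a, h) →
      HasDirDerivAt Q e p (b, h) → e ≤ d - c * (b - a) := by
    intro p h a b d e hab hd he
    refine le_of_tendsto_of_tendsto he (hd.sub_const _) ?_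
    filter_upwards [self_mem_nhdsWithin] with t (ht : 0 < t)
    have := hdec (p.2 + t • h) (p.1 + t * a) (p.1 + t * b) (by gcongr)
    have e1 : p + t • (a, h) = (p.1 + t * a, p.2 + t • h) := rfl
    have e2 : p + t • (b, h) = (p.1 + t * b, p.2 + t • h) := rfl
    rw [e1, e2, smul_eq_mul, smul_eq_mul]
    rw [inv_mul_le_iff₀ ht, mul_sub, mul_inv_cancel_left₀ ht.ne']
    linarith
  have hdirQ : ∀ p h, ∃ d, HasDirDerivAt Q d p h := fun p => (hQ p).directional.self_of_nhds
  have hdir : ∀ z h, ∃ d, HasDirDerivAt Q 0 (γ z, z) (d, h) ∧ HasDirDerivAt γ d z h := by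
    intro z h
    -- Linearised equation: `D` is continuous and strongly decreasing, and its zero is the candidate
    -- for the derivative of γ.
    choose D hD using fun a : ℝ => hdirQ (γ z, z) (a, h)
    obtain ⟨L, U, hU, hL⟩ := (hQ (γ z, z)).lipschitz
    have hDc : Continuous D := by
      have : LipschitzWith L D := by
        refine LipschitzWith.of_dist_le_mul fun a b => ?_
        rw [dist_eq_norm, dist_eq_norm]
        refine ((hD a).norm_sub_le hL hU (hD b)).trans (le_of_eq ?_)
        rw [Prod.mk_sub_mk, sub_self, Prod.norm_mk, norm_zero, max_eq_left (norm_nonneg _)]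
      exact this.continuous
    obtain ⟨d, hd⟩ := exists_zero_of_strongly_decreasing hc hDc
      fun a b hab => hslope _ h a b _ _ hab (hD a) (hD b)
    have hDd : HasDirDerivAt Q 0 (γ z, z) (d, h) := hd ▸ hD d
    refine ⟨d, hDd, ?_⟩
    have hb : Tendsto (fun t : ℝ => c⁻¹ * ‖t⁻¹ • (Q ((γ z, z) + t • (d, h)) - Q (γ z, z))‖)
        (𝓝[>] 0) (𝓝 0) := by
      simpa using (Tendsto.norm hDd).const_mul c⁻¹
    refine tendsto_iff_norm_sub_tendsto_zero.2 (squeeze_zero' ?_ ?_ hb)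
    · exact Eventually.of_forall fun _ => norm_nonneg _
    · filter_upwards [self_mem_nhdsWithin] with t (ht : 0 < t)
      have e1 : (γ z, z) + t • (d, h) = (γ z + t * d, z + t • h) := rfl
      have := mul_abs_sub_le_of_strongly_decreasing (hdec (z + t • h)) (γ (z + t • h))
        (γ z + t * d)
      rw [hγ, zero_sub, abs_neg] at this
      rw [e1, hγ, sub_zero, norm_smul, Real.norm_eq_abs, Real.norm_eq_abs, Real.norm_eq_abs,
        abs_of_pos (inv_pos.2 ht), mul_left_comm, smul_eq_mul]
      have e2 : t⁻¹ * (γ (z + t • h) - γ z) - d = t⁻¹ * (γ (z + t • h) - (γ z + t * d)) := by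
        field_simp
        ring
      rw [e2, abs_mul, abs_of_pos (inv_pos.2 ht)]
      gcongr
      rwa [le_inv_mul_iff₀ hc]
  obtain ⟨L, U, hU, hL⟩ := (hQ (γ z₀, z₀)).lipschitz
  -- Mixed pairs are needed: the Lipschitz bound for γ compares `Q` at (γ z₂, z₁) and (γ z₂, z₂).
  have hU2 : {p : Z × Z | (γ p.1, p.2) ∈ U} ∈ 𝓝 z₀ ×ˢ 𝓝 z₀ := by
    have : Tendsto (fun p : Z × Z => (γ p.1, p.2)) (𝓝 z₀ ×ˢ 𝓝 z₀) (𝓝 (γ z₀, z₀)) :=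
      ((hcont z₀).tendsto.comp tendsto_fst).prodMk_nhds tendsto_snd
    exact this hU
  obtain ⟨W, hW, hWU⟩ := mem_prod_same_iff.1 hU2
  have hLipγ : ∀ z₁ ∈ W, ∀ z₂ ∈ W, |γ z₁ - γ z₂| ≤ c⁻¹ * L * ‖z₁ - z₂‖ := by
    intro z₁ h₁ z₂ h₂
    have i1 := mul_abs_sub_le_of_strongly_decreasing (hdec z₁) (γ z₁) (γ z₂)
    have i2 := hL.norm_sub_le (hWU (mk_mem_prod h₂ h₂)) (hWU (mk_mem_prod h₂ h₁))
    simp only [hγ, Prod.mk_sub_mk, sub_self, Prod.norm_mk, norm_zero, Real.norm_eq_abs] at i1 i2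
    rw [max_eq_right (norm_nonneg _), norm_sub_rev] at i2
    rw [mul_assoc, le_inv_mul_iff₀ hc]
    exact i1.trans i2
  refine ⟨⟨Real.toNNReal c⁻¹ * L, W, hW, ?_⟩, ?_, ?_⟩
  · refine LipschitzOnWith.of_dist_le_mul fun z₁ h₁ z₂ h₂ => ?_
    rw [Real.dist_eq, dist_eq_norm]
    push_cast
    rw [Real.coe_toNNReal _ (by positivity)]
    exact hLipγ z₁ h₁ z₂ h₂
  · exact Eventually.of_forall fun z h => let ⟨d, hd⟩ := hdir z h; ⟨d, hd.2⟩
  · obtain ⟨C, hC⟩ := (hQ (γ z₀, z₀)).quadratic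
    have hpair : Tendsto (fun z => (γ z, z)) (𝓝 z₀) (𝓝 (γ z₀, z₀)) :=
      (hcont z₀).tendsto.prodMk_nhds tendsto_id
    refine ⟨c⁻¹ * (|C| * (max (c⁻¹ * L) 1) ^ 2), ?_⟩
    filter_upwards [hpair.eventually hC, hW] with z h1 hzW d' hd'
    obtain ⟨d, hd0, hd⟩ := hdir z (z - z₀)
    obtain rfl := hd'.unique hd
    obtain ⟨e, he⟩ := hdirQ (γ z, z) ((γ z, z) - (γ z₀, z₀))
    have i1 := h1 e he
    rw [hγ, hγ, sub_zero, zero_sub, norm_neg, Real.norm_eq_abs, Prod.mk_sub_mk] at i1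
    rw [Prod.mk_sub_mk] at he
    -- Since `Q` vanishes at both points, its derivative `e` along the true increment is
    -- quadratically small; along (d', z − z₀) it is 0. Strong decrease turns this into a bound on
    -- the difference of the first components.
    have i2 : c * |γ z - γ z₀ - d'| ≤ |e| := by
      rcases le_total (γ z - γ z₀) d' with h | h
      · have := hslope _ _ _ _ _ _ h he hd0
        rw [abs_of_nonpos (by linarith)]
        linarith [le_abs_self e]
      · have := hslope _ _ _ _ _ _ h hd0 he
        rw [abs_of_nonneg (by linarith)]
        linarith [neg_abs_le e]
    have i3 : ‖(γ z - γ z₀, z - z₀)‖ ≤ max (c⁻¹ * L) 1 * ‖z - z₀‖ := by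
      rw [Prod.norm_mk, Real.norm_eq_abs, max_mul_of_nonneg _ _ (norm_nonneg _), one_mul]
      exact max_le_max (hLipγ z hzW z₀ (mem_of_mem_nhds hW)) le_rfl
    rw [Real.norm_eq_abs, mul_assoc, le_inv_mul_iff₀ hc]
    calc _ ≤ C * ‖(γ z - γ z₀, z - z₀)‖ ^ 2 := i2.trans i1
      _ ≤ |C| * (max (c⁻¹ * L) 1 * ‖z - z₀‖) ^ 2 := by
        gcongr
        exact le_abs_self C
      _ = _ := by ring

end Implicit

/-! ### Soft thresholding -/

section SoftThreshold

variable {X : Type*} [NormedAddCommGroup X] [NormedSpace ℝ X]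

/-- Soft thresholding: shrink the norm of `p.1` by `p.2`. -/
noncomputable def softThreshold (p : X × ℝ) : X := max 0 (‖p.1‖ - max 0 p.2) • ‖p.1‖⁻¹ • p.1

lemma norm_inv_norm_smul_le_one (x : X) : ‖‖x‖⁻¹ • x‖ ≤ 1 := by
  rw [norm_smul, norm_inv, norm_norm]
  exact inv_mul_le_one

lemma norm_smul_inv_norm_smul (x : X) : ‖x‖ • ‖x‖⁻¹ • x = x := by
  rcases eq_or_ne x 0 with rfl | hx
  · simp
  · exact smul_inv_smul₀ (norm_ne_zero_iff.2 hx) x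

/-- The unit direction jumps at the origin, but its increment carries a factor of at most ‖q.1‖,
which tames it. The constant is 2 from the length plus 2 from the direction. -/
lemma norm_softThreshold_sub_le (p q : X × ℝ) :
    ‖softThreshold p - softThreshold q‖ ≤ 4 * ‖p - q‖ := by
  set ψ : X × ℝ → ℝ := fun p => max 0 (‖p.1‖ - max 0 p.2) with hψ
  set n : X → X := fun x => ‖x‖⁻¹ • x with hn
  have hp : ‖p.1 - q.1‖ ≤ ‖p - q‖ := le_max_left _ _
  have hq : |p.2 - q.2| ≤ ‖p - q‖ := le_max_right _ _
  have hnorm : |‖p.1‖ - ‖q.1‖| ≤ ‖p - q‖ := (abs_norm_sub_norm_le _ _).trans hp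
  have h1 : |ψ p - ψ q| ≤ 2 * ‖p - q‖ := by
    have hpos : ∀ a b : ℝ, |max 0 a - max 0 b| ≤ |a - b| := fun a b => by
      rw [max_comm 0 a, max_comm 0 b]
      exact abs_max_sub_max_le_abs a b 0
    have a1 := hpos (‖p.1‖ - max 0 p.2) (‖q.1‖ - max 0 q.2)
    have a2 := hpos p.2 q.2
    have a3 : (‖p.1‖ - max 0 p.2) - (‖q.1‖ - max 0 q.2)
      = (‖p.1‖ - ‖q.1‖) - (max 0 p.2 - max 0 q.2) := by ring
    rw [a3] at a1
    have a4 := abs_sub (‖p.1‖ - ‖q.1‖) (max 0 p.2 - max 0 q.2)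
    simp only [hψ]
    linarith
  have h2 : ψ q * ‖n p.1 - n q.1‖ ≤ 2 * ‖p - q‖ := by
    have b1 : ψ q ≤ ‖q.1‖ :=
      max_le (norm_nonneg _) (by linarith [le_max_left 0 q.2])
    have b2 : ‖q.1‖ * ‖n p.1 - n q.1‖ = ‖(‖q.1‖ - ‖p.1‖) • n p.1 + (p.1 - q.1)‖ := by
      rw [← norm_norm q.1, ← norm_smul, norm_norm]
      congr 1
      simp only [hn]
      rw [smul_sub, sub_smul, norm_smul_inv_norm_smul, norm_smul_inv_norm_smul]
      abel
    calc ψ q * ‖n p.1 - n q.1‖ ≤ ‖q.1‖ * ‖n p.1 - n q.1‖ := by gcongr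
      _ ≤ ‖(‖q.1‖ - ‖p.1‖) • n p.1‖ + ‖p.1 - q.1‖ := by rw [b2]; exact norm_add_le _ _
      _ ≤ |‖q.1‖ - ‖p.1‖| * 1 + ‖p.1 - q.1‖ := by
        rw [norm_smul, Real.norm_eq_abs]
        gcongr
        exact norm_inv_norm_smul_le_one _
      _ ≤ _ := by rw [abs_sub_comm]; linarith
  have h3 : softThreshold p - softThreshold q
      = (ψ p - ψ q) • n p.1 + ψ q • (n p.1 - n q.1) := by
    simp only [softThreshold, hψ, hn]
    rw [sub_smul, smul_sub]
    abel
  calc _ ≤ ‖(ψ p - ψ q) • n p.1‖ + ‖ψ q • (n p.1 - n q.1)‖ := by rw [h3]; exact norm_add_le _ _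
    _ ≤ |ψ p - ψ q| * 1 + ψ q * ‖n p.1 - n q.1‖ := by
      rw [norm_smul (ψ p - ψ q), norm_smul (ψ q), Real.norm_eq_abs,
        Real.norm_of_nonneg (show 0 ≤ ψ q from le_max_left _ _)]
      gcongr
      exact norm_inv_norm_smul_le_one _
    _ ≤ _ := by linarith

/-- Joint positive homogeneity in the vector and the threshold settles the origin. At (0, r) with r
≠ 0 the map is locally the projection or zero; the clamp `max 0 p.2` is what gives the projection
for r < 0. Elsewhere the direction is smooth. -/
lemma dirSemismoothAt_softThreshold
    (hX : ∀ x : X, x ≠ 0 → ContDiffAt ℝ 2 (fun y : X => ‖y‖) x) (p : X × ℝ) :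
    DirSemismoothAt (softThreshold (X := X)) p := by
  have hne : ∀ p : X × ℝ, p ≠ 0 → DirSemismoothAt (softThreshold (X := X)) p := by
    rintro ⟨x, r⟩ hp
    rcases eq_or_ne x 0 with rfl | hx
    · have hr : r ≠ 0 := by rintro rfl; exact hp rfl
      rcases hr.lt_or_gt with hr | hr
      · refine (DirSemismoothAt.fst _).congr ?_
        filter_upwards [continuous_snd.continuousAt.eventually (Iio_mem_nhds hr)] with q hq
        rw [softThreshold, max_eq_left (le_of_lt hq), sub_zero, max_eq_right (norm_nonneg _),
          norm_smul_inv_norm_smul]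
      · refine (DirSemismoothAt.const (0 : X) _).congr ?_
        have hlt : ∀ᶠ q : X × ℝ in 𝓝 (0, r), ‖q.1‖ < q.2 :=
          (isOpen_lt (by fun_prop) (by fun_prop)).mem_nhds (by simpa using hr)
        filter_upwards [hlt] with q hq
        rw [softThreshold, max_eq_left, zero_smul]
        linarith [le_max_right 0 q.2]
    · have hnorm : DirSemismoothAt (fun q : X × ℝ => ‖q.1‖) (x, r) :=
        DirSemismoothAt.comp (g := fun y : X => ‖y‖) (DirSemismoothAt.norm hX x)
          (DirSemismoothAt.fst _)
      have hmax : DirSemismoothAt (fun q : X × ℝ => max 0 q.2) (x, r) :=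
        DirSemismoothAt.comp (g := fun t : ℝ => max 0 t) (DirSemismoothAt.max_zero _)
          (DirSemismoothAt.snd _)
      have hψ : DirSemismoothAt (fun q : X × ℝ => max 0 (‖q.1‖ - max 0 q.2)) (x, r) :=
        DirSemismoothAt.comp (g := fun t : ℝ => max 0 t) (DirSemismoothAt.max_zero _)
          (hnorm.sub hmax)
      have hn : DirSemismoothAt (fun q : X × ℝ => ‖q.1‖⁻¹ • q.1) (x, r) := by
        refine DirSemismoothAt.comp (g := fun y : X => ‖y‖⁻¹ • y) ?_ (DirSemismoothAt.fst _)
        exact .of_contDiffAt (((hX x hx).inv (norm_ne_zero_iff.2 hx)).smul contDiffAt_id)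
      exact hψ.smul hn
  rcases eq_or_ne p 0 with rfl | hp
  · refine .of_posHomogeneous (fun t ht q => ?_) ⟨4, univ, univ_mem, ?_⟩
      fun x hx => (hne x hx).directional.self_of_nhds
    · simp only [softThreshold, Prod.smul_fst, Prod.smul_snd, norm_smul, smul_eq_mul,
        Real.norm_of_nonneg ht.le]
      have hmax : ∀ s : ℝ, max 0 (t * s) = t * max 0 s := fun s => by
        rw [mul_max_of_nonneg _ _ ht.le, mul_zero]
      rw [hmax, ← mul_sub, hmax, mul_smul, mul_inv, mul_smul, smul_comm _ t q.1, inv_smul_smul₀ ht.ne']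
    · refine LipschitzOnWith.of_dist_le_mul fun a _ b _ => ?_
      rw [dist_eq_norm, dist_eq_norm]
      exact norm_softThreshold_sub_le a b
  · exact hne p hp

end SoftThreshold

/-! ### Smoothness of the tensor invariants -/

namespace SymTensor

lemma norm_eq_sqrt_ddot (σ : SymTensor) : ‖σ‖ = √(ddot σ σ) := by
  change ‖σ.1‖ = _
  rw [Matrix.frobenius_norm_def, Real.sqrt_eq_rpow, ddot]
  simp [sq]

lemma rho_eq_norm_dev (σ : SymTensor) : rho σ = ‖dev σ‖ := (norm_eq_sqrt_ddot _).symm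

lemma contDiff_entry (i j : Fin 3) {k : WithTop ℕ∞} :
    ContDiff ℝ k fun σ : SymTensor => σ.1 i j :=
  (LinearMap.toContinuousLinearMap
    ({ toFun := fun σ : SymTensor => σ.1 i j
       map_add' := fun _ _ => rfl
       map_smul' := fun _ _ => rfl } : SymTensor →ₗ[ℝ] ℝ)).contDiff

lemma contDiff_ddot {X : Type*} [NormedAddCommGroup X] [NormedSpace ℝ X] {k : WithTop ℕ∞}
    {f g : X → SymTensor} (hf : ContDiff ℝ k f) (hg : ContDiff ℝ k g) :
    ContDiff ℝ k fun x => ddot (f x) (g x) :=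
  ContDiff.sum fun i _ => ContDiff.sum fun j _ =>
    ((contDiff_entry i j).comp hf).mul ((contDiff_entry i j).comp hg)

lemma contDiff_p {k : WithTop ℕ∞} : ContDiff ℝ k p :=
  (contDiff_ddot contDiff_const contDiff_id).div_const 3

lemma contDiff_dev {k : WithTop ℕ∞} : ContDiff ℝ k dev :=
  contDiff_id.sub (((contDiff_ddot contDiff_const contDiff_id).div_const 3).smul contDiff_const)

lemma contDiffAt_norm_of_ne_zero (σ : SymTensor) (hσ : σ ≠ 0) :
    ContDiffAt ℝ 2 (fun τ : SymTensor => ‖τ‖) σ := by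
  have h : (fun τ : SymTensor => ‖τ‖) = fun τ => √(ddot τ τ) := funext norm_eq_sqrt_ddot
  rw [h]
  refine (contDiff_ddot contDiff_id contDiff_id).contDiffAt.sqrt fun h0 => hσ ?_
  rw [← norm_eq_zero, norm_eq_sqrt_ddot]
  simp only [id] at h0
  rw [h0, Real.sqrt_zero]

lemma dirSemismoothAt_rho (σ : SymTensor) : DirSemismoothAt rho σ := by
  have h : rho = (fun τ : SymTensor => ‖τ‖) ∘ dev := funext rho_eq_norm_dev
  rw [h]
  exact (DirSemismoothAt.norm contDiffAt_norm_of_ne_zero _).comp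
    (.of_contDiffAt contDiff_dev.contDiffAt)

end SymTensor

/-! ### The extended function `q` and the closed form of the return map -/

namespace DruckerPrager

open SymTensor

/-- The function `q` with the hardening function extended by its value at `0`, as a function of
the multiplier and the trial stress. -/
noncomputable def qExt (m : DruckerPrager) (ebar : ℝ) (z : ℝ × SymTensor) : ℝ :=
  m.yield (p z.2 - z.1 * (m.K * m.ηbar)) (max 0 (rho z.2 - z.1 * (m.G * √2)))
    (m.H (max (ebar + z.1 * m.ξ) 0))

variable (m : DruckerPrager)

lemma contDiff_trialStress (epl : SymTensor) {k : WithTop ℕ∞} :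
    ContDiff ℝ k (m.trialStress epl) := by
  have h : ContDiff ℝ k fun ε : SymTensor => ε - epl := contDiff_id.sub contDiff_const
  exact ((contDiff_const.mul (contDiff_ddot contDiff_const h)).smul contDiff_const).add
    ((contDiff_dev.comp h).const_smul (2 * m.G))

lemma qtr_eq_qExt (hξ : 0 < m.ξ) {ebar : ℝ} (hebar : 0 ≤ ebar) (σ : SymTensor) {γ : ℝ}
    (hγ : 0 ≤ γ) : m.qtr σ ebar γ = m.qExt ebar (γ, σ) := by
  have : 0 ≤ ebar + γ * m.ξ := by positivity
  simp only [qtr, q, qExt, max_eq_left this]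

/-- The pressure term alone supplies the rate; the shear and hardening terms are merely
nonincreasing in the multiplier. -/
lemma qExt_le (hG : 0 < m.G) (hξ : 0 < m.ξ)
    (hH : MonotoneOn m.H (Ici 0)) (ebar : ℝ) (σ : SymTensor) (a b : ℝ) (hab : a ≤ b) :
    m.qExt ebar (b, σ) ≤ m.qExt ebar (a, σ) - m.η * (m.K * m.ηbar) * (b - a) := by
  have h1 : m.H (max (ebar + a * m.ξ) 0) ≤ m.H (max (ebar + b * m.ξ) 0) :=
    hH (mem_Ici.2 (le_max_right _ _)) (mem_Ici.2 (le_max_right _ _)) (by gcongr)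
  have h2 : max 0 (rho σ - b * (m.G * √2)) ≤ max 0 (rho σ - a * (m.G * √2)) := by
    gcongr
  have h3 := mul_le_mul_of_nonneg_left h2 (Real.sqrt_nonneg (1 / 2))
  have h4 := mul_le_mul_of_nonneg_left h1 hξ.le
  simp only [qExt, yield]
  nlinarith

lemma dirSemismoothAt_qExt (hH : StronglySemismoothOn (fun s : ℝ => m.H (max s 0)) univ)
    (ebar : ℝ) (z : ℝ × SymTensor) : DirSemismoothAt (m.qExt ebar) z := by
  have h1 : DirSemismoothAt (fun z : ℝ × SymTensor => m.H (max (ebar + z.1 * m.ξ) 0)) z := by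
    refine DirSemismoothAt.comp (g := fun s : ℝ => m.H (max s 0))
      (StronglySemismoothAt.dirSemismoothAt (fun x => hH x (mem_univ x)) _)
      (.of_contDiffAt ?_)
    fun_prop
  have h2 : DirSemismoothAt (fun z : ℝ × SymTensor => max 0 (rho z.2 - z.1 * (m.G * √2))) z := by
    refine DirSemismoothAt.comp (g := fun t : ℝ => max 0 t) (.max_zero _)
      (.sub ((dirSemismoothAt_rho z.2).comp (.snd z)) (.of_contDiffAt ?_))
    fun_prop
  have h3 : DirSemismoothAt
      (fun z : ℝ × SymTensor => m.η * (p z.2 - z.1 * (m.K * m.ηbar))) z := by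
    refine .of_contDiffAt (contDiffAt_const.mul ?_)
    exact (contDiff_p.comp contDiff_snd).contDiffAt.sub (contDiffAt_fst.mul contDiffAt_const)
  exact (((DirSemismoothAt.const (√(1 / 2)) z).smul h2).add h3).sub
    ((DirSemismoothAt.const m.ξ z).smul ((DirSemismoothAt.const m.c₀ z).add h1))

/-- The return mapping in closed form, given the plastic multiplier as the positive part of the
zero of the extended function `q`. -/
lemma returnMap_eq (hK : 0 < m.K) (hG : 0 < m.G) (hη : 0 < m.η) (hηbar : 0 < m.ηbar)
    (hξ : 0 < m.ξ) (hH : MonotoneOn m.H (Ici 0)) {ebar : ℝ} (hebar : 0 ≤ ebar)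
    {σ : SymTensor} {γ : ℝ} (hγ : m.qExt ebar (γ, σ) = 0) :
    m.returnMap σ ebar = (p σ - max 0 γ * (m.K * m.ηbar)) • one
      + softThreshold (dev σ, max 0 γ * (m.G * √2)) := by
  have hc : 0 < m.η * (m.K * m.ηbar) := by positivity
  have hd : 0 < m.G * √2 := by positivity
  have hdec := m.qExt_le hG hξ hH ebar σ
  have hlt : ∀ a b, a < b → m.qExt ebar (b, σ) < m.qExt ebar (a, σ) := fun a b hab => by
    have := hdec a b hab.le
    have := mul_pos hc (sub_pos.2 hab)
    linarith
  have hinj : ∀ a, m.qExt ebar (a, σ) = 0 → a = γ := fun a ha => by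
    rcases lt_trichotomy a γ with h | h | h
    · linarith [hlt _ _ h]
    · exact h
    · linarith [hlt _ _ h]
  have hsoft : ∀ r, 0 ≤ r →
      softThreshold (dev σ, r) = max 0 (rho σ - r) • SymTensor.n σ := fun r hr => by
    rw [softThreshold, SymTensor.n, rho_eq_norm_dev, max_eq_right hr]
  have hρ : 0 ≤ rho σ := Real.sqrt_nonneg _
  -- Valid also for ϱ = 0, where the deviator itself vanishes.
  have hρn : rho σ • SymTensor.n σ = dev σ := by
    rw [SymTensor.n, rho_eq_norm_dev, norm_smul_inv_norm_smul]
  have hsplit : p σ • one + dev σ = σ := by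
    rw [dev, p, add_sub_cancel]
  rw [returnMap, qtr_eq_qExt m hξ hebar σ le_rfl,
    qtr_eq_qExt m hξ hebar σ (div_nonneg hρ hd.le)]
  split_ifs with h0 h1
  · have : γ ≤ 0 := by
      by_contra! h
      linarith [hlt _ _ h]
    rw [max_eq_left this, zero_mul, zero_mul, sub_zero, hsoft 0 le_rfl, sub_zero,
      max_eq_right hρ, hρn, hsplit]
  all_goals
    have hγ0 : 0 < γ := by
      by_contra! h
      have := hdec _ _ h
      have := mul_nonneg hc.le (sub_nonneg.2 h)
      linarith
    have hmul : m.multiplier σ ebar = γ := by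
      have hex : ∃ γ, 0 ≤ γ ∧ m.qtr σ ebar γ = 0 :=
        ⟨γ, hγ0.le, by rw [qtr_eq_qExt m hξ hebar σ hγ0.le, hγ]⟩
      rw [multiplier, dif_pos hex]
      have hs := hex.choose_spec
      rw [qtr_eq_qExt m hξ hebar σ hs.1] at hs
      exact hinj _ hs.2
    rw [hmul, max_eq_right hγ0.le, hsoft _ (by positivity)]
  -- Return to the smooth portion: the zero lies before ϱ/(G√2), so the positive part in the
  -- threshold is inactive.
  · have hlt' : γ < rho σ / (m.G * √2) := by
      by_contra! h
      have := hdec _ _ h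
      have := mul_nonneg hc.le (sub_nonneg.2 h)
      linarith
    rw [lt_div_iff₀ hd] at hlt'
    have hσ : p σ • one + rho σ • SymTensor.n σ = σ := by rw [hρn, hsplit]
    rw [max_eq_right (by linarith)]
    calc _ = p σ • one + rho σ • SymTensor.n σ
          - γ • ((m.G * √2) • SymTensor.n σ + (m.K * m.ηbar) • one) := by rw [hσ]
      _ = _ := by module
  -- Apex: the threshold is at least ϱ and removes the deviator.
  · have hle : rho σ / (m.G * √2) ≤ γ := by
      by_contra! h
      linarith [hlt _ _ h]
    rw [div_le_iff₀ hd] at hle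
    rw [max_eq_left (by linarith), zero_smul, add_zero]

end DruckerPrager

open SymTensor DruckerPrager in
theorem mainTheorem2 (m : DruckerPrager)
    (hK : 0 < m.K) (hG : 0 < m.G) (hη : 0 < m.η) (hηbar : 0 < m.ηbar) (hξ : 0 < m.ξ)
    (hc₀ : 0 < m.c₀)
    -- the hardening function on `[0, ∞)`: nondecreasing, `H 0 = 0`, strongly semismooth
    -- (at the end point `0` in the one-sided sense, that is, for its constant extension)
    (hHmono : MonotoneOn m.H (Set.Ici 0)) (hH0 : m.H 0 = 0)
    (hHsemi : StronglySemismoothOn (fun s : ℝ => m.H (max s 0)) Set.univ)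
    (epl : SymTensor) (ebar : ℝ) (hebar : 0 ≤ ebar) :
    -- the plastic multiplier is well defined whenever it is used
    (∀ ε : SymTensor, 0 ≤ m.qtr (m.trialStress epl ε) ebar 0 →
      ∃! γ : ℝ, 0 ≤ γ ∧ m.qtr (m.trialStress epl ε) ebar γ = 0) ∧
    StronglySemismoothOn (m.T epl ebar) Set.univ := by
  have hc : 0 < m.η * (m.K * m.ηbar) := by positivity
  have hdec := m.qExt_le hG hξ hHmono ebar
  have hQ := m.dirSemismoothAt_qExt hHsemi ebar
  have hex : ∀ σ, ∃ γ, m.qExt ebar (γ, σ) = 0 := fun σ => by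
    refine exists_zero_of_strongly_decreasing hc ?_ (hdec σ)
    have h : Continuous (m.qExt ebar) := continuous_iff_continuousAt.2 fun z => (hQ z).continuousAt
    exact h.comp (by fun_prop)
  choose γ hγ using hex
  refine ⟨fun ε h0 => ?_, fun ε _ => ?_⟩
  · set σ := m.trialStress epl ε
    rw [qtr_eq_qExt m hξ hebar σ le_rfl] at h0
    have hγ0 : 0 ≤ γ σ := by
      by_contra! h
      have h1 := hdec σ _ _ h.le
      rw [hγ] at h1
      nlinarith [mul_pos hc (sub_pos.2 h)]
    refine ⟨γ σ, ⟨hγ0, by rw [qtr_eq_qExt m hξ hebar σ hγ0, hγ]⟩, ?_⟩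
    rintro a ⟨ha0, ha⟩
    rw [qtr_eq_qExt m hξ hebar σ ha0] at ha
    have h1 := mul_abs_sub_le_of_strongly_decreasing (hdec σ) a (γ σ)
    rw [ha, hγ, sub_self, abs_zero] at h1
    have h2 : |a - γ σ| ≤ 0 := nonpos_of_mul_nonpos_right h1 hc
    exact sub_eq_zero.1 (abs_nonpos_iff.1 h2)
  · refine DirSemismoothAt.stronglySemismoothAt ?_
    have hret : m.T epl ebar = (fun σ => (p σ - max 0 (γ σ) * (m.K * m.ηbar)) • one
        + softThreshold (dev σ, max 0 (γ σ) * (m.G * √2))) ∘ m.trialStress epl :=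
      funext fun ε => m.returnMap_eq hK hG hη hηbar hξ hHmono hebar (hγ _)
    rw [hret]
    refine DirSemismoothAt.comp ?_ (.of_contDiffAt (m.contDiff_trialStress epl).contDiffAt)
    set σ := m.trialStress epl ε
    have hmul : DirSemismoothAt (fun σ => max 0 (γ σ)) σ :=
      DirSemismoothAt.comp (g := fun t : ℝ => max 0 t) (.max_zero _)
        (.implicit hc hdec hγ hQ σ)
    have hp : DirSemismoothAt p σ := .of_contDiffAt contDiff_p.contDiffAt
    have hdev : DirSemismoothAt dev σ := .of_contDiffAt contDiff_dev.contDiffAt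
    refine .add ((hp.sub (hmul.smul (.const _ _))).smul (.const _ _)) ?_
    exact DirSemismoothAt.comp (g := softThreshold)
      (dirSemismoothAt_softThreshold contDiffAt_norm_of_ne_zero _)
      (hdev.prodMk (hmul.smul (.const _ _)))
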